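/- Let $\psi=\Gamma'/\Gamma$ be the digamma function, $\psi^{(k)}$ its $k$-th derivative ($\psi^{(0)}=\psi$), $\gamma$ the Euler–Mascheroni constant, $\zeta$ the Riemann zeta function, and $H_n^{(s)}=\sum_{k=1}^n k^{-s}$, $H_n=H_n^{(1)}$ (so $H_0=H_0^{(s)}=0$). For $z\in\mathbb C\setminus\mathbb Z_{\le -1}$ put $$\begin{aligned} g(z)={}&-\gamma^3-3\gamma\,\zeta(2)-2\zeta(3)-3\{\gamma^2+\zeta(2)\}\,\psi(z+1)+3\gamma\,\psi'(z+1)-\psi''(z+1)\\ &+3\,\psi(z+1)\,\psi'(z+1)-3\gamma\,(\psi(z+1))^2-(\psi(z+1))^3 .\end{aligned}$$ Then for every $p\in\mathbb C\setminus\mathbb Z_{\le 0}$ and every integer $m\ge 1$, the following series converges (absolutely) and $$\sum_{k=1}^{\infty}\frac{H_{k-1}^2-H_{k-1}^{(2)}}{k\,(p+k)^m}=\frac{(-1)^m}{3\,(m-1)!}\sum_{\ell=0}^{m-1}\binom{m-1}{\ell}(-1)^{m-1-\ell}\,\frac{(m-1-\ell)!}{p^{\,m-\ell}}\;g^{(\ell)}(p).$$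 Moreover, $g$ is holomorphic on $\mathbb C\setminus\mathbb Z_{\le -1}$, and for every $z\in\mathbb C\setminus\mathbb Z_{\le -1}$ and every integer $\ell\ge 1$, $$\begin{aligned} g^{(\ell)}(z)={}&-3\{\gamma^2+\zeta(2)\}\,\psi^{(\ell)}(z+1)+3\gamma\,\psi^{(\ell+1)}(z+1)-\psi^{(\ell+2)}(z+1)\\ &+3\sum_{j=0}^{\ell}\binom{\ell}{j}\psi^{(j+1)}(z+1)\,\psi^{(\ell-j)}(z+1)-3\gamma\sum_{j=0}^{\ell}\binom{\ell}{j}\psi^{(j)}(z+1)\,\psi^{(\ell-j)}(z+1)\\ &-\sum_{k=0}^{\ell}\binom{\ell}{k}\Big\{\sum_{j=0}^{k}\binom{k}{j}\psi^{(j)}(z+1)\,\psi^{(k-j)}(z+1)\Big\}\psi^{(\ell-k)}(z+1).\end{aligned}$$ -/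

import Mathlib

noncomputable section

/-- The generalized harmonic number `H_n^{(s)} = ∑_{k=1}^n 1 / k^s` of order `s ∈ ℂ`
(so that `H_0^{(s)} = 0`). -/
def genHarmonic (s : ℂ) (n : ℕ) : ℂ :=
  ∑ k ∈ Finset.Icc 1 n, 1 / (k : ℂ) ^ s

/-- The polygamma function `ψ^{(k)}`, the `k`-th derivative of the digamma function
`ψ = Γ' / Γ`; in particular `ψ^{(0)} = ψ`. -/
def polygamma (k : ℕ) (z : ℂ) : ℂ :=
  iteratedDeriv k Complex.digamma z

/-- The function
`g(z) = -γ³ - 3γζ(2) - 2ζ(3) - 3(γ² + ζ(2))ψ(z+1) + 3γψ'(z+1) - ψ''(z+1)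
  + 3ψ(z+1)ψ'(z+1) - 3γψ(z+1)² - ψ(z+1)³`. -/
def gFun (z : ℂ) : ℂ :=
  -(Real.eulerMascheroniConstant : ℂ) ^ 3
    - 3 * (Real.eulerMascheroniConstant : ℂ) * riemannZeta 2 - 2 * riemannZeta 3
    - 3 * ((Real.eulerMascheroniConstant : ℂ) ^ 2 + riemannZeta 2) * polygamma 0 (z + 1)
    + 3 * (Real.eulerMascheroniConstant : ℂ) * polygamma 1 (z + 1)
    - polygamma 2 (z + 1)
    + 3 * polygamma 0 (z + 1) * polygamma 1 (z + 1)
    - 3 * (Real.eulerMascheroniConstant : ℂ) * polygamma 0 (z + 1) ^ 2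
    - polygamma 0 (z + 1) ^ 3

end

open Filter Topology

/-! Put W_s(z) = ∑_j (1/(j+1)^s - 1/(j+1+z)^s), which interpolates H_n^{(s)}, and let A and B be the
s = 1 sums with term j weighted by H_j and by H_j² - H_j^{(2)}. The core is 2A = W_1² + W_2 and 3B =
W_1³ + 3 W_1 W_2 + 2 W_3 (`two_mul_weightedSum_genHarmonic`, `three_mul_weightedSum_harmonicSqSub`).
Summation by parts gives the difference equations in z, so the difference D of the two sides is
1-periodic. It vanishes at 0, and D(p+n) - D(n) → 0 because these differences are built from tails
of convergent series; hence D = 0.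

The same principle with monotonicity of ψ on the positive reals, followed by the identity theorem,
gives ψ(z+1) = W_1(z) - γ (`digamma_add_one_eq`). Differentiating yields ψ' and ψ'' in terms of ζ(2)
- W_2 and ζ(3) - W_3, and the cubic identity becomes g = -3B.

Since the series for m = 1 is B(p)/p = -g(p)/(3p), differentiating it m - 1 times, termwise on one
side and by Leibniz on the other, gives the formula (`harmonicPowSum_eq`). -/

/-! ### The domain, and bounding j+1+z away from zero -/

/-- The complement of the negative integers. -/
def complNegInt : Set ℂ := {z : ℂ | ∀ n : ℕ, z + 1 ≠ -(n : ℂ)}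

lemma add_one_mem_complNegInt {z : ℂ} (hz : z ∈ complNegInt) : z + 1 ∈ complNegInt := by
  intro n h
  exact hz (n + 1) (by push_cast; linear_combination h)

lemma add_natCast_mem_complNegInt {z : ℂ} (hz : z ∈ complNegInt) (n : ℕ) :
    z + n ∈ complNegInt := by
  induction n with
  | zero => simpa using hz
  | succ n ih =>
    have := add_one_mem_complNegInt ih
    rwa [add_assoc, ← Nat.cast_succ] at this

lemma natCast_mem_complNegInt (n : ℕ) : (n : ℂ) ∈ complNegInt := by
  intro k h
  have : ((n + 1 + k : ℕ) : ℂ) = 0 := by push_cast; linear_combination h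
  rw [Nat.cast_eq_zero] at this
  omega

lemma add_ne_zero_of_mem_complNegInt {z : ℂ} (hz : z ∈ complNegInt) (j : ℕ) :
    (j : ℂ) + 1 + z ≠ 0 := fun h => hz j (by linear_combination h)

lemma add_one_ne_zero_of_mem_complNegInt {z : ℂ} (hz : z ∈ complNegInt) : z + 1 ≠ 0 := by
  simpa using hz 0

/-- For j ≥ N ≥ 2‖z‖ the factor 2 suffices; each of the finitely many smaller j contributes its own
ratio to the constant. -/
lemma exists_pos_mul_le_norm_add {z : ℂ} (hz : z ∈ complNegInt) :
    ∃ c : ℝ, 0 < c ∧ ∀ j : ℕ, c * ((j : ℝ) + 1) ≤ ‖(j : ℂ) + 1 + z‖ := by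
  have hj (j : ℕ) : ‖(j : ℂ) + 1‖ = (j : ℝ) + 1 := by
    exact_mod_cast Complex.norm_natCast (j + 1)
  have hb : ∃ K : ℝ, 0 < K ∧ ∀ j : ℕ, ((j : ℝ) + 1) ≤ K * ‖(j : ℂ) + 1 + z‖ := by
    obtain ⟨N, hN⟩ := exists_nat_ge (2 * ‖z‖)
    refine ⟨2 + ∑ i ∈ Finset.range N, ((i : ℝ) + 1) / ‖(i : ℂ) + 1 + z‖, by positivity,
      fun j => ?_⟩
    have hpos : 0 < ‖(j : ℂ) + 1 + z‖ := norm_pos_iff.2 (add_ne_zero_of_mem_complNegInt hz j)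
    rcases lt_or_ge j N with h | h
    · have h1 := Finset.single_le_sum (f := fun i : ℕ => ((i : ℝ) + 1) / ‖(i : ℂ) + 1 + z‖)
        (fun i _ => by positivity) (Finset.mem_range.2 h)
      rw [← div_le_iff₀ hpos]
      linarith
    · have h1 : (N : ℝ) ≤ j := by exact_mod_cast h
      have h2 := norm_sub_le ((j : ℂ) + 1 + z) z
      rw [add_sub_cancel_right, hj] at h2
      have h3 : 0 ≤ ∑ i ∈ Finset.range N, ((i : ℝ) + 1) / ‖(i : ℂ) + 1 + z‖ :=
        Finset.sum_nonneg fun i _ => by positivity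
      nlinarith
  obtain ⟨K, hK, h⟩ := hb
  exact ⟨K⁻¹, by positivity, fun j => by rw [inv_mul_le_iff₀ hK]; exact h j⟩

/-! ### Growth of the harmonic weights -/

/-- A monotone majorant of the squares of harmonic numbers. -/
def harmonicWeight (j : ℕ) : ℝ := (1 + (harmonic j : ℝ)) ^ 2

lemma harmonic_cast_nonneg (j : ℕ) : 0 ≤ (harmonic j : ℝ) := by
  rw [harmonic]; positivity

lemma harmonic_cast_succ (j : ℕ) : (harmonic (j + 1) : ℝ) = harmonic j + 1 / ((j : ℝ) + 1) := by
  rw [harmonic_succ]; push_cast; ring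

lemma harmonicWeight_mono : Monotone harmonicWeight := by
  refine monotone_nat_of_le_succ fun j => ?_
  have h0 := harmonic_cast_nonneg j
  have : 0 ≤ 1 / ((j : ℝ) + 1) := by positivity
  rw [harmonicWeight, harmonicWeight, harmonic_cast_succ]
  gcongr
  linarith

lemma one_le_harmonicWeight (j : ℕ) : 1 ≤ harmonicWeight j := by
  have h0 := harmonic_cast_nonneg j
  rw [harmonicWeight]; nlinarith

/-- With x = j+1, 1 + H_j ≤ 2 + log x ≤ 2 + 4x^(1/4) ≤ 6x^(1/4). Any exponent below 1 would serve
the two uses that follow. -/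
lemma harmonicWeight_le (j : ℕ) : harmonicWeight j ≤ 36 * ((j : ℝ) + 1) ^ (1 / 2 : ℝ) := by
  have h0 := harmonic_cast_nonneg j
  have hx : (1 : ℝ) ≤ (j : ℝ) + 1 := by simp
  have h1 : (harmonic j : ℝ) ≤ 1 + Real.log ((j : ℝ) + 1) := by
    have h := harmonic_le_one_add_log (j + 1)
    rw [harmonic_cast_succ] at h
    have : 0 ≤ 1 / ((j : ℝ) + 1) := by positivity
    push_cast at h
    linarith
  have h2 := Real.log_le_rpow_div (x := (j : ℝ) + 1) (by positivity) (ε := 1 / 4) (by norm_num)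
  have h3 : 1 ≤ ((j : ℝ) + 1) ^ (1 / 4 : ℝ) := Real.one_le_rpow hx (by norm_num)
  have h4 : ((j : ℝ) + 1) ^ (1 / 2 : ℝ) = (((j : ℝ) + 1) ^ (1 / 4 : ℝ)) ^ 2 := by
    rw [← Real.rpow_natCast, ← Real.rpow_mul (by positivity)]; norm_num
  rw [h4, harmonicWeight, show (36 : ℝ) = 6 ^ 2 by norm_num, ← mul_pow]
  gcongr
  linarith

lemma summable_harmonicWeight_div_sq :
    Summable fun j : ℕ => harmonicWeight j / ((j : ℝ) + 1) ^ 2 := by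
  have hs : Summable fun j : ℕ => 36 * (1 / ((j : ℝ) + 1) ^ (3 / 2 : ℝ)) := by
    have := (summable_nat_add_iff 1).2
      (Real.summable_one_div_nat_rpow.2 (show (1 : ℝ) < 3 / 2 by norm_num))
    simpa using this.mul_left 36
  refine hs.of_nonneg_of_le (fun j => ?_) fun j => ?_
  · have := one_le_harmonicWeight j
    positivity
  · have hx : (0 : ℝ) < (j : ℝ) + 1 := by positivity
    have : ((j : ℝ) + 1) ^ (2 : ℕ) = ((j : ℝ) + 1) ^ (1 / 2 : ℝ) * ((j : ℝ) + 1) ^ (3 / 2 : ℝ) := by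
      rw [← Real.rpow_add hx, ← Real.rpow_natCast]; norm_num
    rw [this, mul_one_div, div_le_div_iff₀ (by positivity) (by positivity)]
    have h := harmonicWeight_le j
    have h' : 0 ≤ ((j : ℝ) + 1) ^ (3 / 2 : ℝ) := by positivity
    nlinarith [mul_le_mul_of_nonneg_right h h']

lemma tendsto_harmonicWeight_div :
    Tendsto (fun j : ℕ => harmonicWeight j / ((j : ℝ) + 1)) atTop (𝓝 0) := by
  have h1 : Tendsto (fun j : ℕ => 36 * ((j : ℝ) + 1) ^ (-(1 / 2) : ℝ)) atTop (𝓝 0) := by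
    have h := (tendsto_rpow_neg_atTop (show (0 : ℝ) < 1 / 2 by norm_num)).comp
      (tendsto_natCast_atTop_atTop.atTop_add (tendsto_const_nhds (x := (1 : ℝ)))
        : Tendsto (fun j : ℕ => (j : ℝ) + 1) atTop atTop)
    simpa using h.const_mul 36
  refine squeeze_zero (fun j => ?_) (fun j => ?_) h1
  · have := one_le_harmonicWeight j
    positivity
  · have hx : (0 : ℝ) < (j : ℝ) + 1 := by positivity
    rw [div_le_iff₀ hx, mul_assoc, ← Real.rpow_add_one hx.ne']
    rw [show -(1 / 2 : ℝ) + 1 = 1 / 2 by norm_num]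
    exact harmonicWeight_le j

/-! ### Weighted difference series and their tails -/

/-- The summands of the series for the digamma function (`s = 1`) and its derivatives. -/
noncomputable def shiftedDiff (s : ℕ) (z : ℂ) (j : ℕ) : ℂ :=
  1 / ((j : ℂ) + 1) ^ s - 1 / ((j : ℂ) + 1 + z) ^ s

lemma shiftedDiff_one {z : ℂ} (hz : z ∈ complNegInt) (j : ℕ) :
    shiftedDiff 1 z j = z / (((j : ℂ) + 1) * ((j : ℂ) + 1 + z)) := by
  have h1 := add_ne_zero_of_mem_complNegInt hz j
  have h2 : (j : ℂ) + 1 ≠ 0 := Nat.cast_add_one_ne_zero j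
  rw [shiftedDiff]
  field_simp
  ring

lemma shiftedDiff_zero (s j : ℕ) : shiftedDiff s 0 j = 0 := by simp [shiftedDiff]

/-- This turns differences between z+n and n into tails of the series at z, the source of all the
asymptotics. -/
lemma shiftedDiff_add_natCast_sub (s : ℕ) (z : ℂ) (n j : ℕ) :
    shiftedDiff s (z + n) j - shiftedDiff s n j = shiftedDiff s z (j + n) := by
  simp only [shiftedDiff]
  push_cast
  rw [show (j : ℂ) + 1 + (z + n) = j + n + 1 + z by ring,
    show (j : ℂ) + n + 1 = j + 1 + n by ring]
  ring

lemma norm_natCast_add_one (j : ℕ) : ‖(j : ℂ) + 1‖ = (j : ℝ) + 1 := by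
  exact_mod_cast Complex.norm_natCast (j + 1)

lemma exists_norm_shiftedDiff_le {s : ℕ} (hs : 1 ≤ s) {z : ℂ} (hz : z ∈ complNegInt) :
    ∃ K : ℝ, ∀ j, ‖shiftedDiff s z j‖ ≤ K / ((j : ℝ) + 1) ^ 2 := by
  obtain ⟨c, hc, h⟩ := exists_pos_mul_le_norm_add hz
  rcases hs.eq_or_lt with rfl | hs
  · refine ⟨‖z‖ / c, fun j => ?_⟩
    rw [shiftedDiff_one hz, norm_div, norm_mul, norm_natCast_add_one, div_div]
    have hx : (0 : ℝ) < (j : ℝ) + 1 := by positivity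
    refine div_le_div_of_nonneg_left (norm_nonneg _) (by positivity) ?_
    nlinarith [mul_le_mul_of_nonneg_left (h j) hx.le]
  · refine ⟨1 + 1 / c ^ s, fun j => ?_⟩
    have hx : (1 : ℝ) ≤ (j : ℝ) + 1 := by simp
    have hp : ((j : ℝ) + 1) ^ 2 ≤ ((j : ℝ) + 1) ^ s := pow_le_pow_right₀ hx hs
    refine (norm_sub_le _ _).trans ?_
    rw [norm_div, norm_div, norm_pow, norm_pow, norm_natCast_add_one, norm_one, add_div, div_div]
    gcongr
    calc c ^ s * ((j : ℝ) + 1) ^ 2 ≤ c ^ s * ((j : ℝ) + 1) ^ s := by gcongr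
      _ = (c * ((j : ℝ) + 1)) ^ s := (mul_pow _ _ _).symm
      _ ≤ _ := by gcongr; exact h j

lemma summable_harmonicWeight_mul_norm_shiftedDiff {s : ℕ} (hs : 1 ≤ s) {z : ℂ}
    (hz : z ∈ complNegInt) : Summable fun j => harmonicWeight j * ‖shiftedDiff s z j‖ := by
  obtain ⟨K, hK⟩ := exists_norm_shiftedDiff_le hs hz
  refine (summable_harmonicWeight_div_sq.mul_left K).of_nonneg_of_le (fun j => ?_) fun j => ?_
  · have := one_le_harmonicWeight j
    positivity
  · have := one_le_harmonicWeight j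
    calc _ ≤ harmonicWeight j * (K / ((j : ℝ) + 1) ^ 2) := by gcongr; exact hK j
      _ = _ := by ring

lemma summable_mul_shiftedDiff {c : ℕ → ℂ} (hc : ∀ j, ‖c j‖ ≤ harmonicWeight j) {s : ℕ}
    (hs : 1 ≤ s) {z : ℂ} (hz : z ∈ complNegInt) : Summable fun j => c j * shiftedDiff s z j := by
  refine .of_norm_bounded (summable_harmonicWeight_mul_norm_shiftedDiff hs hz) fun j => ?_
  rw [norm_mul]
  gcongr
  exact hc j

/-- Coefficients may depend on n, so that a growing factor such as H_n outside the tail can be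
absorbed into it. -/
lemma tendsto_tsum_mul_shiftedDiff_tail {c : ℕ → ℕ → ℂ}
    (hc : ∀ n j, ‖c n j‖ ≤ harmonicWeight (j + n)) {s : ℕ} (hs : 1 ≤ s) {z : ℂ}
    (hz : z ∈ complNegInt) :
    Tendsto (fun n => ∑' j, c n j * shiftedDiff s z (j + n)) atTop (𝓝 0) := by
  have hsum := summable_harmonicWeight_mul_norm_shiftedDiff hs hz
  refine squeeze_zero_norm (fun n => ?_)
    (tendsto_sum_nat_add fun j => harmonicWeight j * ‖shiftedDiff s z j‖)
  refine tsum_of_norm_bounded ((summable_nat_add_iff n).2 hsum).hasSum fun j => ?_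
  rw [norm_mul]
  gcongr
  exact hc n j

/-- The series `∑ c_j (1 / (j + 1) ^ s - 1 / (j + 1 + z) ^ s)`. -/
noncomputable def weightedSum (c : ℕ → ℂ) (s : ℕ) (z : ℂ) : ℂ := ∑' j, c j * shiftedDiff s z j

lemma weightedSum_zero (c : ℕ → ℂ) (s : ℕ) : weightedSum c s 0 = 0 := by
  simp [weightedSum, shiftedDiff_zero]

lemma weightedSum_add_natCast_sub {c : ℕ → ℂ} (hc : ∀ j, ‖c j‖ ≤ harmonicWeight j) {s : ℕ}
    (hs : 1 ≤ s) {z : ℂ} (hz : z ∈ complNegInt) (n : ℕ) :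
    weightedSum c s (z + n) - weightedSum c s n = ∑' j, c j * shiftedDiff s z (j + n) := by
  rw [weightedSum, weightedSum, ← Summable.tsum_sub
    (summable_mul_shiftedDiff hc hs (add_natCast_mem_complNegInt hz n))
    (summable_mul_shiftedDiff hc hs (natCast_mem_complNegInt n))]
  simp_rw [← mul_sub, shiftedDiff_add_natCast_sub]

lemma tendsto_weightedSum_add_natCast_sub {c : ℕ → ℂ} (hc : ∀ j, ‖c j‖ ≤ harmonicWeight j)
    {s : ℕ} (hs : 1 ≤ s) {z : ℂ} (hz : z ∈ complNegInt) :
    Tendsto (fun n : ℕ => weightedSum c s (z + n) - weightedSum c s n) atTop (𝓝 0) := by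
  simp_rw [weightedSum_add_natCast_sub hc hs hz]
  exact tendsto_tsum_mul_shiftedDiff_tail
    (fun n j => (hc j).trans (harmonicWeight_mono (Nat.le_add_right j n))) hs hz

lemma norm_one_le_harmonicWeight (j : ℕ) : ‖(1 : ℕ → ℂ) j‖ ≤ harmonicWeight j := by
  simpa using one_le_harmonicWeight j

lemma tendsto_mul_weightedSum_add_natCast_sub {b : ℕ → ℂ} (hb : ∀ j, ‖b j‖ ≤ harmonicWeight j)
    {s : ℕ} (hs : 1 ≤ s) {z : ℂ} (hz : z ∈ complNegInt) :
    Tendsto (fun n : ℕ => b n * (weightedSum 1 s (z + n) - weightedSum 1 s n)) atTop (𝓝 0) := by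
  simp_rw [weightedSum_add_natCast_sub norm_one_le_harmonicWeight hs hz, ← tsum_mul_left]
  simp only [Pi.one_apply, one_mul]
  exact tendsto_tsum_mul_shiftedDiff_tail
    (fun n j => (hb n).trans (harmonicWeight_mono (Nat.le_add_left n j))) hs hz

/-- Summation by parts. -/
lemma weightedSum_add_one {c : ℕ → ℂ} (hc : ∀ j, ‖c j‖ ≤ harmonicWeight j) {s : ℕ}
    (hs : 1 ≤ s) {z : ℂ} (hz : z ∈ complNegInt) {D : ℂ}
    (hD : HasSum (fun j : ℕ => (c (j + 1) - c j) / ((j : ℂ) + 1 + (z + 1)) ^ s) D) :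
    weightedSum c s (z + 1) = weightedSum c s z + c 0 / (z + 1) ^ s + D := by
  have h1 := (summable_mul_shiftedDiff hc hs (add_one_mem_complNegInt hz)).hasSum.sub
    (summable_mul_shiftedDiff hc hs hz).hasSum
  have h2 := h1.sub hD
  -- The boundary term vanishes because the weight is o(n) and s ≥ 1.
  have h3 : Tendsto (fun n : ℕ => c n / ((n : ℂ) + 1 + z) ^ s) atTop (𝓝 0) := by
    obtain ⟨k, hk, h⟩ := exists_pos_mul_le_norm_add hz
    refine squeeze_zero_norm (fun n => ?_)
      (by simpa using tendsto_harmonicWeight_div.mul_const (1 / k ^ s))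
    have hw := one_le_harmonicWeight n
    have hx : (1 : ℝ) ≤ (n : ℝ) + 1 := by simp
    have hp : ((n : ℝ) + 1) ≤ ((n : ℝ) + 1) ^ s := le_self_pow₀ hx (by omega)
    rw [norm_div, norm_pow, ← one_div, div_mul_div_comm, mul_one]
    refine div_le_div₀ (by linarith) (hc n) (by positivity) ?_
    calc ((n : ℝ) + 1) * k ^ s ≤ ((n : ℝ) + 1) ^ s * k ^ s := by gcongr
      _ = (k * ((n : ℝ) + 1)) ^ s := by rw [mul_pow, mul_comm]
      _ ≤ _ := by gcongr; exact h n
  have h4 : HasSum (fun j : ℕ => c j / ((j : ℂ) + 1 + z) ^ s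
      - c (j + 1) / (((j + 1 : ℕ) : ℂ) + 1 + z) ^ s) (c 0 / (z + 1) ^ s) := by
    have hsum : Summable (fun j : ℕ => c j / ((j : ℂ) + 1 + z) ^ s
        - c (j + 1) / (((j + 1 : ℕ) : ℂ) + 1 + z) ^ s) := by
      refine h2.summable.congr fun j => ?_
      simp only [shiftedDiff]
      push_cast
      rw [show (j : ℂ) + 1 + (z + 1) = j + 1 + 1 + z by ring]
      ring
    rw [hsum.hasSum_iff_tendsto_nat]
    simp_rw [Finset.sum_range_sub']
    simpa [add_comm z 1] using h3.const_sub (c 0 / (((0 : ℕ) : ℂ) + 1 + z) ^ s)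
  have h5 := h4.unique (h2.congr_fun fun j => by
      simp only [shiftedDiff]
      push_cast
      rw [show (j : ℂ) + 1 + (z + 1) = j + 1 + 1 + z by ring]
      ring)
  rw [weightedSum, weightedSum]
  linear_combination -h5

/-! ### Harmonic coefficients and difference equations -/

lemma genHarmonic_zero (s : ℂ) : genHarmonic s 0 = 0 := by simp [genHarmonic]

lemma genHarmonic_natCast_succ (s j : ℕ) :
    genHarmonic s (j + 1) = genHarmonic s j + 1 / ((j : ℂ) + 1) ^ s := by
  rw [genHarmonic, Finset.sum_Icc_succ_top (by omega), genHarmonic]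
  simp

lemma genHarmonic_one_succ (j : ℕ) :
    genHarmonic 1 (j + 1) = genHarmonic 1 j + 1 / ((j : ℂ) + 1) := by
  simpa using genHarmonic_natCast_succ 1 j

lemma genHarmonic_one (j : ℕ) : genHarmonic 1 j = (harmonic j : ℝ) := by
  induction j with
  | zero => simp [genHarmonic_zero]
  | succ j ih => rw [genHarmonic_one_succ, ih, harmonic_cast_succ]; push_cast; ring

lemma norm_genHarmonic_one (j : ℕ) : ‖genHarmonic 1 j‖ = harmonic j := by
  rw [genHarmonic_one, Complex.norm_real, Real.norm_of_nonneg (harmonic_cast_nonneg j)]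

lemma norm_genHarmonic_one_le (j : ℕ) : ‖genHarmonic 1 j‖ ≤ harmonicWeight j := by
  have := harmonic_cast_nonneg j
  rw [norm_genHarmonic_one, harmonicWeight]
  nlinarith

/-- Twice the second elementary symmetric function of `1, 1 / 2, ..., 1 / j`. -/
noncomputable def harmonicSqSub (j : ℕ) : ℂ := genHarmonic 1 j ^ 2 - genHarmonic 2 j

lemma harmonicSqSub_succ (j : ℕ) :
    harmonicSqSub (j + 1) = harmonicSqSub j + 2 * genHarmonic 1 j / ((j : ℂ) + 1) := by
  have h := genHarmonic_natCast_succ 2 j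
  push_cast at h
  rw [harmonicSqSub, harmonicSqSub, genHarmonic_one_succ, h, ← one_div_pow]
  ring

lemma norm_harmonicSqSub_le (j : ℕ) : ‖harmonicSqSub j‖ ≤ harmonicWeight j := by
  have hsq : ‖harmonicSqSub j‖ ≤ (harmonic j : ℝ) ^ 2 := by
    induction j with
    | zero => simp [harmonicSqSub, genHarmonic_zero]
    | succ j ih =>
      rw [harmonicSqSub_succ, harmonic_cast_succ]
      refine (norm_add_le _ _).trans ?_
      rw [norm_div, norm_mul, norm_genHarmonic_one, norm_natCast_add_one, Complex.norm_ofNat]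
      have : 0 ≤ (1 / ((j : ℝ) + 1)) ^ 2 := by positivity
      calc _ ≤ (harmonic j : ℝ) ^ 2 + 2 * harmonic j / ((j : ℝ) + 1) := by gcongr
        _ ≤ _ := by linear_combination this
  have := harmonic_cast_nonneg j
  rw [harmonicWeight]
  nlinarith

lemma weightedSum_one_add_one {s : ℕ} (hs : 1 ≤ s) {z : ℂ} (hz : z ∈ complNegInt) :
    weightedSum 1 s (z + 1) = weightedSum 1 s z + 1 / (z + 1) ^ s := by
  rw [weightedSum_add_one norm_one_le_harmonicWeight hs hz (D := 0) (by simp)]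
  simp

lemma hasSum_mul_shiftedDiff_div {c : ℕ → ℂ} (hc : ∀ j, ‖c j‖ ≤ harmonicWeight j) {z : ℂ}
    (hz : z ∈ complNegInt) (hz0 : z ≠ 0) :
    HasSum (fun j : ℕ => c j / (((j : ℂ) + 1) * (z + ((j : ℂ) + 1)))) (weightedSum c 1 z / z) := by
  refine ((summable_mul_shiftedDiff hc le_rfl hz).hasSum.div_const z).congr_fun fun j => ?_
  rw [shiftedDiff_one hz, add_comm z]
  have h1 := add_ne_zero_of_mem_complNegInt hz j
  have h2 : (j : ℂ) + 1 ≠ 0 := Nat.cast_add_one_ne_zero j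
  field_simp

/-- The increment of H_j is 1/(j+1), so the correction term is the sum with constant weight, divided
by z+1. -/
lemma weightedSum_genHarmonic_add_one {z : ℂ} (hz : z ∈ complNegInt) :
    weightedSum (genHarmonic 1) 1 (z + 1) =
      weightedSum (genHarmonic 1) 1 z + weightedSum 1 1 (z + 1) / (z + 1) := by
  rw [weightedSum_add_one norm_genHarmonic_one_le le_rfl hz
    (D := weightedSum 1 1 (z + 1) / (z + 1))]
  · simp [genHarmonic_zero]
  · refine (hasSum_mul_shiftedDiff_div norm_one_le_harmonicWeight (add_one_mem_complNegInt hz)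
      (add_one_ne_zero_of_mem_complNegInt hz)).congr_fun fun j => ?_
    rw [genHarmonic_one_succ, add_sub_cancel_left, pow_one, div_div, Pi.one_apply,
      add_comm (z + 1)]

lemma weightedSum_harmonicSqSub_add_one {z : ℂ} (hz : z ∈ complNegInt) :
    weightedSum harmonicSqSub 1 (z + 1) =
      weightedSum harmonicSqSub 1 z + 2 * (weightedSum (genHarmonic 1) 1 (z + 1) / (z + 1)) := by
  rw [weightedSum_add_one norm_harmonicSqSub_le le_rfl hz
    (D := 2 * (weightedSum (genHarmonic 1) 1 (z + 1) / (z + 1)))]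
  · simp [harmonicSqSub, genHarmonic_zero]
  · refine ((hasSum_mul_shiftedDiff_div norm_genHarmonic_one_le (add_one_mem_complNegInt hz)
      (add_one_ne_zero_of_mem_complNegInt hz)).mul_left 2).congr_fun fun j => ?_
    rw [harmonicSqSub_succ, add_sub_cancel_left, pow_one, div_div, mul_div_assoc,
      add_comm (z + 1)]

lemma weightedSum_one_natCast {s : ℕ} (hs : 1 ≤ s) (n : ℕ) :
    weightedSum 1 s n = genHarmonic s n := by
  induction n with
  | zero => simp [genHarmonic_zero, weightedSum_zero]
  | succ n ih =>
    rw [genHarmonic_natCast_succ, ← ih, Nat.cast_succ,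
      weightedSum_one_add_one hs (natCast_mem_complNegInt n)]

lemma norm_genHarmonic_two_le (j : ℕ) : ‖genHarmonic 2 j‖ ≤ harmonicWeight j := by
  have h : ‖genHarmonic 2 j‖ ≤ harmonic j := by
    induction j with
    | zero => simp [genHarmonic_zero]
    | succ j ih =>
      have h := genHarmonic_natCast_succ 2 j
      push_cast at h
      rw [h, harmonic_cast_succ]
      refine (norm_add_le _ _).trans (add_le_add ih ?_)
      rw [norm_div, norm_pow, norm_natCast_add_one, norm_one]
      exact one_div_le_one_div_of_le (by positivity) (le_self_pow₀ (by simp) two_ne_zero)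
  have := harmonic_cast_nonneg j
  rw [harmonicWeight]
  nlinarith

/-! ### Evaluation of the weighted sums by periodicity -/

/-- A `1`-periodic function that vanishes at `0` and is asymptotically constant along
translates by natural numbers is zero. -/
lemma eq_zero_of_periodic_of_tendsto {D : ℂ → ℂ} (h0 : D 0 = 0)
    (hD : ∀ z ∈ complNegInt, D (z + 1) = D z) {p : ℂ} (hp : p ∈ complNegInt)
    (hlim : Tendsto (fun n : ℕ => D (p + n) - D n) atTop (𝓝 0)) : D p = 0 := by
  have key (z : ℂ) (hz : z ∈ complNegInt) (n : ℕ) : D (z + n) = D z := by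
    induction n with
    | zero => simp
    | succ n ih => rw [Nat.cast_succ, ← add_assoc, hD _ (add_natCast_mem_complNegInt hz n), ih]
  have h0' (n : ℕ) : D n = 0 := by
    have := key 0 (by simpa using natCast_mem_complNegInt 0) n
    rwa [zero_add, h0] at this
  simp_rw [h0', sub_zero, key p hp] at hlim
  exact tendsto_nhds_unique tendsto_const_nhds hlim

lemma two_mul_weightedSum_genHarmonic {p : ℂ} (hp : p ∈ complNegInt) :
    2 * weightedSum (genHarmonic 1) 1 p = weightedSum 1 1 p ^ 2 + weightedSum 1 2 p := by
  rw [← sub_eq_zero]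
  refine eq_zero_of_periodic_of_tendsto (D := fun p => 2 * weightedSum (genHarmonic 1) 1 p
    - (weightedSum 1 1 p ^ 2 + weightedSum 1 2 p)) (by simp [weightedSum_zero])
    (fun z hz => ?_) hp ?_
  · have hz1 := add_one_ne_zero_of_mem_complNegInt hz
    rw [weightedSum_genHarmonic_add_one hz, weightedSum_one_add_one le_rfl hz,
      weightedSum_one_add_one one_le_two hz]
    field_simp
    ring
  · have hA := tendsto_weightedSum_add_natCast_sub norm_genHarmonic_one_le le_rfl hp
    have h1 := tendsto_weightedSum_add_natCast_sub norm_one_le_harmonicWeight le_rfl hp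
    have h2 := tendsto_weightedSum_add_natCast_sub norm_one_le_harmonicWeight one_le_two hp
    have hH := tendsto_mul_weightedSum_add_natCast_sub norm_genHarmonic_one_le le_rfl hp
    -- With Δ_s = W_s(p+n) - W_s(n) and W_1(n) = H_n, the increment of W_1² is 2H_nΔ_1 + Δ_1².
    have hlim := (((hA.const_mul 2).sub (hH.const_mul 2)).sub (h1.pow 2)).sub h2
    have hz : (2 * 0 - 2 * 0 - 0 ^ 2 - 0 : ℂ) = 0 := by norm_num
    rw [hz] at hlim
    refine hlim.congr fun n => ?_
    have e := weightedSum_one_natCast le_rfl n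
    rw [Nat.cast_one] at e
    rw [← e]
    ring

lemma three_mul_weightedSum_harmonicSqSub {p : ℂ} (hp : p ∈ complNegInt) :
    3 * weightedSum harmonicSqSub 1 p = weightedSum 1 1 p ^ 3
      + 3 * weightedSum 1 1 p * weightedSum 1 2 p + 2 * weightedSum 1 3 p := by
  rw [← sub_eq_zero]
  refine eq_zero_of_periodic_of_tendsto (D := fun p => 3 * weightedSum harmonicSqSub 1 p
    - (weightedSum 1 1 p ^ 3 + 3 * weightedSum 1 1 p * weightedSum 1 2 p + 2 * weightedSum 1 3 p))
    (by simp [weightedSum_zero]) (fun z hz => ?_) hp ?_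
  · have hz1 := add_one_ne_zero_of_mem_complNegInt hz
    -- The difference equation for B involves A(z+1), which the quadratic identity eliminates.
    have e := two_mul_weightedSum_genHarmonic (add_one_mem_complNegInt hz)
    rw [weightedSum_harmonicSqSub_add_one hz, ← mul_div_assoc, e, weightedSum_one_add_one le_rfl hz,
      weightedSum_one_add_one one_le_two hz, weightedSum_one_add_one (by norm_num : 1 ≤ 3) hz]
    field_simp
    ring
  · have hA := tendsto_weightedSum_add_natCast_sub norm_harmonicSqSub_le le_rfl hp
    have h1 := tendsto_weightedSum_add_natCast_sub norm_one_le_harmonicWeight le_rfl hp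
    have h2 := tendsto_weightedSum_add_natCast_sub norm_one_le_harmonicWeight one_le_two hp
    have h3 := tendsto_weightedSum_add_natCast_sub norm_one_le_harmonicWeight
      (by norm_num : 1 ≤ 3) hp
    have hsq (j : ℕ) : ‖genHarmonic 1 j ^ 2‖ ≤ harmonicWeight j := by
      have := harmonic_cast_nonneg j
      rw [norm_pow, norm_genHarmonic_one, harmonicWeight]
      nlinarith
    have hH := tendsto_mul_weightedSum_add_natCast_sub norm_genHarmonic_one_le le_rfl hp
    have hHH := tendsto_mul_weightedSum_add_natCast_sub hsq le_rfl hp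
    have hH2 := tendsto_mul_weightedSum_add_natCast_sub norm_genHarmonic_one_le one_le_two hp
    have hG := tendsto_mul_weightedSum_add_natCast_sub norm_genHarmonic_two_le le_rfl hp
    -- Expansion of the cubic expression in Δ_s around W_s(n) = H_n^{(s)}; every term contains some
    -- Δ_s.
    have hlim := ((((((hA.const_mul 3).sub (hHH.const_mul 3)).sub ((hH.mul h1).const_mul 3)).sub
      (h1.pow 3)).sub ((hG.add (h1.mul h2)).const_mul 3)).sub (hH2.const_mul 3)).sub
      (h3.const_mul 2)
    have hz : (3 * 0 - 3 * 0 - 3 * (0 * 0) - 0 ^ 3 - 3 * (0 + 0 * 0) - 3 * 0 - 2 * 0 : ℂ) = 0 := by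
      norm_num
    rw [hz] at hlim
    refine hlim.congr fun n => ?_
    have e := weightedSum_one_natCast le_rfl n
    have e2 := weightedSum_one_natCast one_le_two n
    rw [Nat.cast_one] at e
    rw [Nat.cast_two] at e2
    rw [← e, ← e2]
    ring

/-! ### Topology of the domain and termwise differentiation -/

lemma exists_ball_subset_complNegInt {z : ℂ} (hz : z ∈ complNegInt) :
    ∃ c : ℝ, 0 < c ∧ ∀ w ∈ Metric.ball z c, w ∈ complNegInt ∧
      ∀ j : ℕ, c * ((j : ℝ) + 1) ≤ ‖(j : ℂ) + 1 + w‖ := by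
  obtain ⟨c, hc, h⟩ := exists_pos_mul_le_norm_add hz
  have key (w : ℂ) (hw : w ∈ Metric.ball z (c / 2)) (j : ℕ) :
      c / 2 * ((j : ℝ) + 1) ≤ ‖(j : ℂ) + 1 + w‖ := by
    rw [mem_ball_iff_norm'] at hw
    have h1 := norm_le_norm_add_norm_sub ((j : ℂ) + 1 + w) ((j : ℂ) + 1 + z)
    rw [add_sub_add_left_eq_sub] at h1
    have h2 := norm_sub_rev z w
    have h3 := h j
    have h4 : (0 : ℝ) ≤ j := by positivity
    nlinarith
  refine ⟨c / 2, by positivity, fun w hw => ⟨fun n hn => ?_, key w hw⟩⟩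
  have h1 := key w hw n
  rw [show (n : ℂ) + 1 + w = 0 by linear_combination hn, norm_zero] at h1
  have : 0 < c / 2 * ((n : ℝ) + 1) := by positivity
  linarith

lemma isOpen_complNegInt : IsOpen complNegInt := by
  rw [Metric.isOpen_iff]
  intro z hz
  obtain ⟨c, hc, h⟩ := exists_ball_subset_complNegInt hz
  exact ⟨c, hc, fun w hw => (h w hw).1⟩

lemma isPreconnected_complNegInt : IsPreconnected complNegInt := by
  have h : complNegInt = (Set.range fun n : ℕ => -(n : ℂ) - 1)ᶜ := by
    ext z
    simp only [complNegInt, Set.mem_ofPred_eq, Set.mem_compl_iff, Set.mem_range, not_exists]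
    exact forall_congr' fun n => not_congr
      ⟨fun h => by linear_combination -h, fun h => by linear_combination -h⟩
  rw [h]
  refine (Set.Countable.isPathConnected_compl_of_one_lt_rank ?_
    (Set.countable_range _)).isConnected.isPreconnected
  rw [Complex.rank_real_complex]
  norm_num

lemma hasDerivAt_tsum_of_mem_complNegInt {b : ℕ → ℂ} {m : ℕ}
    (hb : Summable fun j : ℕ => ‖b j‖ / ((j : ℝ) + 1) ^ m) {f : ℕ → ℂ → ℂ}
    (hf : ∀ j, ∀ w ∈ complNegInt, HasDerivAt (f j) (b j / ((j : ℂ) + 1 + w) ^ m) w) {z : ℂ}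
    (hz : z ∈ complNegInt) (hsum : Summable fun j => f j z) :
    HasDerivAt (fun w => ∑' j, f j w) (∑' j : ℕ, b j / ((j : ℂ) + 1 + z) ^ m) z := by
  obtain ⟨c, hc, h⟩ := exists_ball_subset_complNegInt hz
  have hz' := Metric.mem_ball_self (x := z) hc
  refine hasDerivAt_tsum_of_isPreconnected (hb.mul_left (1 / c ^ m)) Metric.isOpen_ball
    (convex_ball z c).isPreconnected (fun j w hw => hf j w (h w hw).1) (fun j w hw => ?_) hz' hsum
    hz'
  rw [norm_div, norm_pow, div_mul_div_comm, one_mul, ← mul_pow]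
  gcongr
  exact (h w hw).2 j

lemma hasDerivAt_one_div_add_pow (j m : ℕ) {w : ℂ} (hw : w ∈ complNegInt) :
    HasDerivAt (fun w => 1 / ((j : ℂ) + 1 + w) ^ m) (-m / ((j : ℂ) + 1 + w) ^ (m + 1)) w := by
  have hne := add_ne_zero_of_mem_complNegInt hw j
  have h := ((((hasDerivAt_id w).const_add ((j : ℂ) + 1)).pow m).fun_inv (pow_ne_zero m hne))
  simp only [one_div]
  refine h.congr_deriv ?_
  rcases m with _ | m
  · simp
  · simp only [id, mul_one, Nat.add_sub_cancel]
    rw [neg_div, neg_div, neg_inj, Pi.pow_apply,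
      div_eq_div_iff (pow_ne_zero _ (pow_ne_zero _ hne)) (pow_ne_zero _ hne)]
    ring

lemma hasSum_one_div_add_pow {s : ℕ} (hs : 1 ≤ s) {z : ℂ} (hz : z ∈ complNegInt) :
    HasSum (fun j : ℕ => 1 / ((j : ℂ) + 1 + z) ^ (s + 1))
      (riemannZeta (s + 1 : ℕ) - weightedSum 1 (s + 1) z) := by
  have h1 : HasSum (fun j : ℕ => 1 / ((j : ℂ) + 1) ^ (s + 1)) (riemannZeta (s + 1 : ℕ)) := by
    rw [zeta_nat_eq_tsum_of_gt_one (by omega)]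
    have hsum : Summable fun n : ℕ => 1 / (n : ℂ) ^ (s + 1) :=
      .of_norm (by simpa using Real.summable_one_div_nat_pow.2 (show 1 < s + 1 by omega))
    rw [hsum.tsum_eq_zero_add]
    simpa using ((summable_nat_add_iff 1).2 hsum).hasSum
  refine (h1.sub (summable_mul_shiftedDiff norm_one_le_harmonicWeight
    (show 1 ≤ s + 1 by omega) hz).hasSum).congr_fun fun j => ?_
  rw [Pi.one_apply, one_mul, shiftedDiff, sub_sub_cancel]

lemma hasDerivAt_weightedSum_one {s : ℕ} (hs : 1 ≤ s) {z : ℂ} (hz : z ∈ complNegInt) :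
    HasDerivAt (weightedSum 1 s) (s * (riemannZeta (s + 1 : ℕ) - weightedSum 1 (s + 1) z)) z := by
  have hb : Summable fun j : ℕ => ‖(s : ℂ)‖ / ((j : ℝ) + 1) ^ (s + 1) := by
    have := (summable_nat_add_iff 1).2
      (Real.summable_one_div_nat_pow.2 (show 1 < s + 1 by omega))
    simpa [div_eq_mul_inv] using this.mul_left ‖(s : ℂ)‖
  have h := hasDerivAt_tsum_of_mem_complNegInt (b := fun _ => (s : ℂ)) hb
    (f := fun j w => (1 : ℕ → ℂ) j * shiftedDiff s w j) (fun j w hw => ?_) hz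
    (summable_mul_shiftedDiff norm_one_le_harmonicWeight hs hz)
  · refine h.congr_deriv ?_
    rw [← ((hasSum_one_div_add_pow hs hz).mul_left (s : ℂ)).tsum_eq]
    simp_rw [mul_one_div]
  · simp only [Pi.one_apply, one_mul, shiftedDiff]
    refine ((hasDerivAt_one_div_add_pow j s hw).const_sub _).congr_deriv ?_
    ring

/-! ### Partial fractions of the digamma function -/

lemma differentiableAt_digamma {z : ℂ} (hz : ∀ n : ℕ, z ≠ -(n : ℂ)) :
    DifferentiableAt ℂ Complex.digamma z := by
  have hset : IsOpen {z : ℂ | ∀ n : ℕ, z ≠ -(n : ℂ)} := by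
    have : {z : ℂ | ∀ n : ℕ, z ≠ -(n : ℂ)} = (fun z => z - 1) ⁻¹' complNegInt := by
      ext z; simp [complNegInt]
    rw [this]
    exact isOpen_complNegInt.preimage (by fun_prop)
  have hG : DifferentiableOn ℂ Complex.Gamma {z : ℂ | ∀ n : ℕ, z ≠ -(n : ℂ)} :=
    fun w hw => (Complex.differentiableAt_Gamma w hw).differentiableWithinAt
  have hG' := (hG.deriv hset).differentiableAt (hset.mem_nhds hz)
  exact hG'.div (Complex.differentiableAt_Gamma z hz) (Complex.Gamma_ne_zero hz)

lemma digamma_ofReal {x : ℝ} (hx : 0 < x) :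
    Complex.digamma x = (deriv (Real.log ∘ Real.Gamma) x : ℝ) := by
  have hne (m : ℕ) : x ≠ -m := ne_of_gt (by linarith [(Nat.cast_nonneg m : (0 : ℝ) ≤ m)])
  have hneC (m : ℕ) : (x : ℂ) ≠ -m := fun h => hne m (by exact_mod_cast h)
  have h1 := (Complex.differentiableAt_Gamma x hneC).hasDerivAt.comp_ofReal
  have h2 := (Real.differentiableAt_Gamma hne).hasDerivAt.ofReal_comp
  simp_rw [Complex.Gamma_ofReal] at h1
  rw [Function.comp_def, deriv.log (Real.differentiableAt_Gamma hne) (Real.Gamma_pos_of_pos hx).ne',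
    Complex.digamma_def, logDeriv_apply, h1.unique h2, Complex.Gamma_ofReal]
  push_cast
  rfl

/-- Log-convexity of Γ makes ψ increasing, so ψ(x+n+1) lies between ψ(n+1) and ψ(n+2) = ψ(n+1) +
1/(n+1). -/
lemma norm_digamma_add_natCast_sub_le {x : ℝ} (hx : x ∈ Set.Ioo (0 : ℝ) 1) (n : ℕ) :
    ‖Complex.digamma (x + n + 1) - Complex.digamma (n + 1)‖ ≤ 1 / ((n : ℝ) + 1) := by
  obtain ⟨hx0, hx1⟩ := hx
  have hmono : MonotoneOn (deriv (Real.log ∘ Real.Gamma)) (Set.Ioi 0) := by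
    refine Real.convexOn_log_Gamma.monotoneOn_deriv fun y hy => ?_
    have hy' : 0 < y := hy
    have hne (m : ℕ) : y ≠ -m := ne_of_gt (by linarith [(Nat.cast_nonneg m : (0 : ℝ) ≤ m)])
    exact (Real.differentiableAt_Gamma hne).log (Real.Gamma_ne_zero hne)
  have hn : (0 : ℝ) ≤ n := Nat.cast_nonneg n
  have h1 := hmono (show (n : ℝ) + 1 ∈ Set.Ioi 0 by simp; positivity)
    (show x + n + 1 ∈ Set.Ioi 0 by simp; positivity) (by linarith)
  have h2 := hmono (show x + n + 1 ∈ Set.Ioi 0 by simp; positivity)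
    (show (n : ℝ) + 1 + 1 ∈ Set.Ioi 0 by simp; positivity) (by linarith)
  have e0 := digamma_ofReal (x := n + 1) (by positivity)
  have e1 := digamma_ofReal (x := x + n + 1) (by positivity)
  have e2 := digamma_ofReal (x := n + 1 + 1) (by positivity)
  have h3 := Complex.digamma_apply_add_one ((n : ℂ) + 1) (natCast_mem_complNegInt n)
  push_cast at e0 e1 e2
  have h4 : deriv (Real.log ∘ Real.Gamma) (n + 1 + 1)
      = deriv (Real.log ∘ Real.Gamma) (n + 1) + ((n : ℝ) + 1)⁻¹ := by
    rw [e0, e2] at h3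
    rw [← Complex.ofReal_inj]
    push_cast
    exact h3
  rw [e0, e1, ← Complex.ofReal_sub, Complex.norm_real, Real.norm_of_nonneg (by linarith), one_div]
  linarith

lemma digamma_add_one_ofReal {x : ℝ} (hx : x ∈ Set.Ioo (0 : ℝ) 1) :
    Complex.digamma (x + 1) = weightedSum 1 1 x - Real.eulerMascheroniConstant := by
  have hmem : (x : ℂ) ∈ complNegInt := by
    intro n h
    have h' : x + 1 = -n := by exact_mod_cast h
    linarith [hx.1, (Nat.cast_nonneg n : (0 : ℝ) ≤ n)]
  suffices Complex.digamma (x + 1) + Real.eulerMascheroniConstant - weightedSum 1 1 x = 0 by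
    linear_combination this
  refine eq_zero_of_periodic_of_tendsto (D := fun z => Complex.digamma (z + 1)
    + Real.eulerMascheroniConstant - weightedSum 1 1 z)
    (by simp [weightedSum_zero, Complex.digamma_one]) (fun z hz => ?_) hmem ?_
  · rw [Complex.digamma_apply_add_one _ hz, weightedSum_one_add_one le_rfl hz]
    ring
  · have h1 := tendsto_weightedSum_add_natCast_sub norm_one_le_harmonicWeight le_rfl hmem
    have h2 : Tendsto (fun n : ℕ => Complex.digamma (x + n + 1) - Complex.digamma (n + 1)) atTop
        (𝓝 0) :=
      squeeze_zero_norm (norm_digamma_add_natCast_sub_le hx) tendsto_one_div_add_atTop_nhds_zero_nat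
    have h3 := h2.sub h1
    rw [sub_zero] at h3
    refine h3.congr fun n => ?_
    ring

/-- The partial fraction expansion of the digamma function. -/
lemma digamma_add_one_eq {z : ℂ} (hz : z ∈ complNegInt) :
    Complex.digamma (z + 1) = weightedSum 1 1 z - Real.eulerMascheroniConstant := by
  have hf : AnalyticOnNhd ℂ (fun z => Complex.digamma (z + 1)) complNegInt := by
    refine DifferentiableOn.analyticOnNhd (fun w hw => ?_) isOpen_complNegInt
    exact (DifferentiableAt.comp w (f := fun w => w + 1) (differentiableAt_digamma hw)
      (by fun_prop)).differentiableWithinAt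
  have hg : AnalyticOnNhd ℂ (fun z => weightedSum 1 1 z - Real.eulerMascheroniConstant)
      complNegInt := by
    refine DifferentiableOn.analyticOnNhd (fun w hw => ?_) isOpen_complNegInt
    exact ((hasDerivAt_weightedSum_one le_rfl hw).differentiableAt.sub_const _)
      |>.differentiableWithinAt
  refine hf.eqOn_of_preconnected_of_frequently_eq hg isPreconnected_complNegInt
    (z₀ := ((1 / 2 : ℝ) : ℂ)) ?_ ?_ hz
  · intro n h
    have h' : (1 / 2 : ℝ) + 1 = -n := by exact_mod_cast h
    linarith [(Nat.cast_nonneg n : (0 : ℝ) ≤ n)]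
  · have ht : Tendsto (fun x : ℝ => (x : ℂ)) (𝓝[≠] (1 / 2)) (𝓝[≠] ((1 / 2 : ℝ) : ℂ)) :=
      tendsto_nhdsWithin_of_tendsto_nhds_of_eventually_within _
        (Complex.continuous_ofReal.continuousAt.mono_left nhdsWithin_le_nhds)
        (eventually_mem_nhdsWithin.mono fun x hx => by
          simpa only [Set.mem_compl_iff, Set.mem_singleton_iff, Complex.ofReal_inj] using hx)
    refine ht.frequently (Eventually.frequently ?_)
    have := Ioo_mem_nhds (show (0 : ℝ) < 1 / 2 by norm_num) (show (1 / 2 : ℝ) < 1 by norm_num)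
    filter_upwards [nhdsWithin_le_nhds this] with x hx
    exact digamma_add_one_ofReal hx

/-! ### Polygamma values and derivatives of g -/

lemma analyticAt_digamma {z : ℂ} (hz : z ∈ complNegInt) :
    AnalyticAt ℂ Complex.digamma (z + 1) := by
  have h : ∀ᶠ w in 𝓝 (z + 1), DifferentiableAt ℂ Complex.digamma w := by
    have hc : ContinuousAt (fun w : ℂ => w - 1) (z + 1) := by fun_prop
    have hz' : z + 1 - 1 ∈ complNegInt := by simpa using hz
    filter_upwards [hc.preimage_mem_nhds (isOpen_complNegInt.mem_nhds hz')] with w hw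
    exact differentiableAt_digamma fun n => by simpa using hw n
  exact Complex.analyticAt_iff_eventually_differentiableAt.2 h

lemma analyticAt_polygamma_add_one (k : ℕ) {z : ℂ} (hz : z ∈ complNegInt) :
    AnalyticAt ℂ (fun w => polygamma k (w + 1)) z := by
  have h : AnalyticAt ℂ (polygamma k) (z + 1) := by
    have := (analyticAt_digamma hz).iterated_deriv k
    rwa [← iteratedDeriv_eq_iterate] at this
  exact AnalyticAt.fun_comp h (by fun_prop)

lemma iteratedDeriv_polygamma_add_one (k l : ℕ) (z : ℂ) :
    iteratedDeriv l (fun w => polygamma k (w + 1)) z = polygamma (l + k) (z + 1) := by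
  rw [iteratedDeriv_comp_add_const]
  have : polygamma k = deriv^[k] Complex.digamma := iteratedDeriv_eq_iterate
  rw [polygamma, iteratedDeriv_eq_iterate, iteratedDeriv_eq_iterate, this,
    Function.iterate_add_apply]

lemma hasDerivAt_polygamma_add_one (k : ℕ) {z : ℂ} (hz : z ∈ complNegInt) :
    HasDerivAt (fun w => polygamma k (w + 1)) (polygamma (k + 1) (z + 1)) z := by
  have h := (analyticAt_polygamma_add_one k hz).differentiableAt.hasDerivAt
  rwa [← iteratedDeriv_one, iteratedDeriv_polygamma_add_one, add_comm] at h

lemma polygamma_zero_add_one {z : ℂ} (hz : z ∈ complNegInt) :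
    polygamma 0 (z + 1) = weightedSum 1 1 z - Real.eulerMascheroniConstant := by
  rw [polygamma, iteratedDeriv_zero, digamma_add_one_eq hz]

lemma polygamma_one_add_one {z : ℂ} (hz : z ∈ complNegInt) :
    polygamma 1 (z + 1) = riemannZeta 2 - weightedSum 1 2 z := by
  have h := (hasDerivAt_weightedSum_one le_rfl hz).sub_const (Real.eulerMascheroniConstant : ℂ)
  have e := (hasDerivAt_polygamma_add_one 0 hz).unique (h.congr_of_eventuallyEq
    (eventually_of_mem (isOpen_complNegInt.mem_nhds hz) fun w hw => polygamma_zero_add_one hw))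
  simpa using e

lemma polygamma_two_add_one {z : ℂ} (hz : z ∈ complNegInt) :
    polygamma 2 (z + 1) = -2 * (riemannZeta 3 - weightedSum 1 3 z) := by
  have h := (hasDerivAt_weightedSum_one one_le_two hz).const_sub (riemannZeta 2)
  have e := (hasDerivAt_polygamma_add_one 1 hz).unique (h.congr_of_eventuallyEq
    (eventually_of_mem (isOpen_complNegInt.mem_nhds hz) fun w hw => polygamma_one_add_one hw))
  simpa using e

lemma gFun_eq_weightedSum {z : ℂ} (hz : z ∈ complNegInt) :
    gFun z = -3 * weightedSum harmonicSqSub 1 z := by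
  rw [gFun, neg_mul, three_mul_weightedSum_harmonicSqSub hz, polygamma_zero_add_one hz,
    polygamma_one_add_one hz, polygamma_two_add_one hz]
  ring

lemma analyticAt_gFun {z : ℂ} (hz : z ∈ complNegInt) : AnalyticAt ℂ gFun z := by
  have h0 := analyticAt_polygamma_add_one 0 hz
  have h1 := analyticAt_polygamma_add_one 1 hz
  have h2 := analyticAt_polygamma_add_one 2 hz
  unfold gFun
  fun_prop

lemma iteratedDeriv_gFun {z : ℂ} (hz : z ∈ complNegInt) {l : ℕ} (hl : 1 ≤ l) :
    iteratedDeriv l gFun z =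
      -3 * ((Real.eulerMascheroniConstant : ℂ) ^ 2 + riemannZeta 2) * polygamma l (z + 1)
      + 3 * (Real.eulerMascheroniConstant : ℂ) * polygamma (l + 1) (z + 1)
      - polygamma (l + 2) (z + 1)
      + 3 * ∑ j ∈ Finset.range (l + 1),
          (Nat.choose l j : ℂ) * polygamma (j + 1) (z + 1) * polygamma (l - j) (z + 1)
      - 3 * (Real.eulerMascheroniConstant : ℂ) * ∑ j ∈ Finset.range (l + 1),
          (Nat.choose l j : ℂ) * polygamma j (z + 1) * polygamma (l - j) (z + 1)
      - ∑ k ∈ Finset.range (l + 1), (Nat.choose l k : ℂ) *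
          (∑ j ∈ Finset.range (k + 1),
            (Nat.choose k j : ℂ) * polygamma j (z + 1) * polygamma (k - j) (z + 1))
          * polygamma (l - k) (z + 1) := by
  let P : ℕ → ℂ → ℂ := fun k w => polygamma k (w + 1)
  have hP (k n : ℕ) : ContDiffAt ℂ n (P k) z := (analyticAt_polygamma_add_one k hz).contDiffAt
  have hd (k n : ℕ) : iteratedDeriv n (P k) z = polygamma (n + k) (z + 1) :=
    iteratedDeriv_polygamma_add_one k n z
  have hmul (a b n : ℕ) : iteratedDeriv n (P a * P b) z = ∑ j ∈ Finset.range (n + 1),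
      (Nat.choose n j : ℂ) * polygamma (j + a) (z + 1) * polygamma (n - j + b) (z + 1) := by
    rw [iteratedDeriv_mul (hP a n) (hP b n)]
    simp_rw [hd]
  have hcube : iteratedDeriv l (P 0 * P 0 * P 0) z = ∑ k ∈ Finset.range (l + 1),
      (Nat.choose l k : ℂ) * (∑ j ∈ Finset.range (k + 1),
        (Nat.choose k j : ℂ) * polygamma j (z + 1) * polygamma (k - j) (z + 1))
        * polygamma (l - k) (z + 1) := by
    have hsq : ContDiffAt ℂ l (P 0 * P 0) z := (hP 0 l).mul (hP 0 l)
    rw [iteratedDeriv_mul hsq (hP 0 l)]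
    simp_rw [hd, hmul, add_zero]
  set γ : ℂ := (Real.eulerMascheroniConstant : ℂ) with hγ
  have hg : gFun = fun w => (-γ ^ 3 - 3 * γ * riemannZeta 2 - 2 * riemannZeta 3)
      + ((-3 * (γ ^ 2 + riemannZeta 2)) • P 0 + (3 * γ) • P 1 - P 2 + (3 : ℂ) • (P 1 * P 0)
        - (3 * γ) • (P 0 * P 0) - P 0 * P 0 * P 0) w := by
    funext w
    simp only [gFun, P, Pi.add_apply, Pi.sub_apply, Pi.smul_apply, Pi.mul_apply, smul_eq_mul, ← hγ]
    ring
  have c0 := hP 0 l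
  have c1 := hP 1 l
  have c2 := hP 2 l
  have s0 : ContDiffAt ℂ l ((-3 * (γ ^ 2 + riemannZeta 2)) • P 0) z :=
    c0.const_smul (-3 * (γ ^ 2 + riemannZeta 2))
  have s1 : ContDiffAt ℂ l ((3 * γ) • P 1) z := c1.const_smul (3 * γ)
  have s2 : ContDiffAt ℂ l ((3 : ℂ) • (P 1 * P 0)) z := (c1.mul c0).const_smul (3 : ℂ)
  have s3 : ContDiffAt ℂ l ((3 * γ) • (P 0 * P 0)) z := (c0.mul c0).const_smul (3 * γ)
  have s4 : ContDiffAt ℂ l (P 0 * P 0 * P 0) z := (c0.mul c0).mul c0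
  have t1 : ContDiffAt ℂ l ((-3 * (γ ^ 2 + riemannZeta 2)) • P 0 + (3 * γ) • P 1) z := s0.add s1
  have t2 : ContDiffAt ℂ l ((-3 * (γ ^ 2 + riemannZeta 2)) • P 0 + (3 * γ) • P 1 - P 2) z :=
    t1.sub c2
  have t3 : ContDiffAt ℂ l ((-3 * (γ ^ 2 + riemannZeta 2)) • P 0 + (3 * γ) • P 1 - P 2
      + (3 : ℂ) • (P 1 * P 0)) z := t2.add s2
  have t4 : ContDiffAt ℂ l ((-3 * (γ ^ 2 + riemannZeta 2)) • P 0 + (3 * γ) • P 1 - P 2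
      + (3 : ℂ) • (P 1 * P 0) - (3 * γ) • (P 0 * P 0)) z := t3.sub s3
  -- Here l ≥ 1 removes the constant term of g.
  rw [hg, iteratedDeriv_const_add hl, iteratedDeriv_sub t4 s4, iteratedDeriv_sub t3 s3,
    iteratedDeriv_add t2 s2, iteratedDeriv_sub t1 c2, iteratedDeriv_add s0 s1]
  simp only [iteratedDeriv_const_smul_field, smul_eq_mul, hcube, hmul, hd, add_zero]

/-! ### The series with powers, by repeated differentiation -/

/-- The series `∑ (H_j ^ 2 - H_j^{(2)}) / ((j + 1) (j + 1 + z) ^ m)`. -/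
noncomputable def harmonicPowSum (m : ℕ) (z : ℂ) : ℂ :=
  ∑' j : ℕ, harmonicSqSub j / ((j : ℂ) + 1) / ((j : ℂ) + 1 + z) ^ m

lemma summable_norm_harmonicSqSub_div {m : ℕ} (hm : 1 ≤ m) :
    Summable fun j : ℕ => ‖harmonicSqSub j / ((j : ℂ) + 1)‖ / ((j : ℝ) + 1) ^ m := by
  refine summable_harmonicWeight_div_sq.of_nonneg_of_le (fun j => by positivity) fun j => ?_
  have hx : (1 : ℝ) ≤ (j : ℝ) + 1 := by simp
  have := one_le_harmonicWeight j
  rw [norm_div, norm_natCast_add_one, div_div, ← pow_succ']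
  exact div_le_div₀ (by linarith) (norm_harmonicSqSub_le j) (by positivity)
    (pow_le_pow_right₀ hx (by omega))

lemma summable_harmonicPowSum {m : ℕ} (hm : 1 ≤ m) {z : ℂ} (hz : z ∈ complNegInt) :
    Summable fun j : ℕ => harmonicSqSub j / ((j : ℂ) + 1) / ((j : ℂ) + 1 + z) ^ m := by
  obtain ⟨c, hc, h⟩ := exists_pos_mul_le_norm_add hz
  refine .of_norm_bounded ((summable_norm_harmonicSqSub_div hm).mul_left (1 / c ^ m)) fun j => ?_
  rw [norm_div, norm_pow, div_mul_div_comm, one_mul, ← mul_pow]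
  gcongr
  exact h j

lemma hasDerivAt_harmonicPowSum {m : ℕ} (hm : 1 ≤ m) {z : ℂ} (hz : z ∈ complNegInt) :
    HasDerivAt (harmonicPowSum m) (-m * harmonicPowSum (m + 1) z) z := by
  have h := hasDerivAt_tsum_of_mem_complNegInt (m := m + 1)
    (b := fun j => -m * (harmonicSqSub j / ((j : ℂ) + 1)))
    (by
      refine ((summable_norm_harmonicSqSub_div (m := m + 1) (by omega)).mul_left
        ‖(-m : ℂ)‖).congr fun j => ?_
      rw [norm_mul, mul_div_assoc])
    (f := fun j w => harmonicSqSub j / ((j : ℂ) + 1) / ((j : ℂ) + 1 + w) ^ m)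
    (fun j w hw => ?_) hz (summable_harmonicPowSum hm hz)
  · refine h.congr_deriv ?_
    rw [harmonicPowSum, ← tsum_mul_left]
    simp_rw [mul_div_assoc]
  · have h := (hasDerivAt_one_div_add_pow j m hw).const_mul (harmonicSqSub j / ((j : ℂ) + 1))
    simp only [mul_one_div] at h
    refine h.congr_deriv ?_
    ring

lemma iteratedDeriv_harmonicPowSum (l : ℕ) {z : ℂ} (hz : z ∈ complNegInt) :
    iteratedDeriv l (harmonicPowSum 1) z =
      (-1) ^ l * (Nat.factorial l : ℂ) * harmonicPowSum (l + 1) z := by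
  induction l generalizing z with
  | zero => simp
  | succ l ih =>
    have he : iteratedDeriv l (harmonicPowSum 1) =ᶠ[𝓝 z]
        fun w => (-1) ^ l * (Nat.factorial l : ℂ) * harmonicPowSum (l + 1) w :=
      eventually_of_mem (isOpen_complNegInt.mem_nhds hz) fun w hw => ih hw
    rw [iteratedDeriv_succ, he.deriv_eq,
      ((hasDerivAt_harmonicPowSum (by omega : 1 ≤ l + 1) hz).const_mul _).deriv, Nat.factorial_succ]
    push_cast
    ring

lemma harmonicPowSum_one {z : ℂ} (hz : z ∈ complNegInt) (hz0 : z ≠ 0) :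
    harmonicPowSum 1 z = -1 / 3 * (gFun z * z⁻¹) := by
  rw [gFun_eq_weightedSum hz, harmonicPowSum]
  have h := hasSum_mul_shiftedDiff_div norm_harmonicSqSub_le hz hz0
  have e (j : ℕ) : harmonicSqSub j / ((j : ℂ) + 1) / ((j : ℂ) + 1 + z) ^ 1
      = harmonicSqSub j / (((j : ℂ) + 1) * (z + ((j : ℂ) + 1))) := by
    rw [pow_one, div_div, add_comm z]
  simp_rw [e]
  rw [h.tsum_eq]
  ring

lemma iteratedDeriv_inv_complex (k : ℕ) (z : ℂ) :
    iteratedDeriv k (fun w : ℂ => w⁻¹) z = (-1) ^ k * ((Nat.factorial k : ℂ) / z ^ (k + 1)) := by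
  rw [iteratedDeriv_eq_iterate]
  have := iter_deriv_inv (𝕜 := ℂ) k z
  simp only [Inv.inv] at this ⊢
  rw [this, show (-1 - k : ℤ) = -((k + 1 : ℕ) : ℤ) by push_cast; ring, zpow_neg, zpow_natCast]
  ring

lemma harmonicPowSum_eq {z : ℂ} (hz : z ∈ complNegInt) (hz0 : z ≠ 0) {m : ℕ} (hm : 1 ≤ m) :
    harmonicPowSum m z = (-1 : ℂ) ^ m / (3 * (Nat.factorial (m - 1) : ℂ)) *
      ∑ l ∈ Finset.range m, (Nat.choose (m - 1) l : ℂ) * (-1 : ℂ) ^ (m - 1 - l)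
        * ((Nat.factorial (m - 1 - l) : ℂ) / z ^ (m - l)) * iteratedDeriv l gFun z := by
  obtain ⟨n, rfl⟩ : ∃ n, m = n + 1 := ⟨m - 1, by omega⟩
  have he : harmonicPowSum 1 =ᶠ[𝓝 z] fun w => -1 / 3 * (gFun w * w⁻¹) := by
    filter_upwards [isOpen_complNegInt.mem_nhds hz, isOpen_ne.mem_nhds hz0] with w hw hw0
    exact harmonicPowSum_one hw hw0
  have h := he.iteratedDeriv_eq n
  rw [iteratedDeriv_harmonicPowSum n hz, iteratedDeriv_const_mul_field,
    iteratedDeriv_fun_mul (analyticAt_gFun hz).contDiffAt (contDiffAt_inv ℂ hz0)] at h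
  simp_rw [iteratedDeriv_inv_complex] at h
  have hsum : ∑ l ∈ Finset.range (n + 1), (Nat.choose n l : ℂ) * (-1 : ℂ) ^ (n - l)
        * ((Nat.factorial (n - l) : ℂ) / z ^ (n + 1 - l)) * iteratedDeriv l gFun z
      = ∑ l ∈ Finset.range (n + 1), (Nat.choose n l : ℂ) * iteratedDeriv l gFun z
        * ((-1) ^ (n - l) * ((Nat.factorial (n - l) : ℂ) / z ^ (n - l + 1))) := by
    refine Finset.sum_congr rfl fun l hl => ?_
    rw [Nat.sub_add_comm (Nat.lt_succ_iff.1 (Finset.mem_range.1 hl))]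
    ring
  have hfac : (Nat.factorial n : ℂ) ≠ 0 := Nat.cast_ne_zero.2 n.factorial_ne_zero
  have hsign : (-1 : ℂ) ^ n * (-1) ^ n = 1 := by rw [← mul_pow]; simp
  rw [Nat.add_sub_cancel, hsum]
  set T := ∑ l ∈ Finset.range (n + 1), (Nat.choose n l : ℂ) * iteratedDeriv l gFun z
        * ((-1) ^ (n - l) * ((Nat.factorial (n - l) : ℂ) / z ^ (n - l + 1)))
  rw [div_mul_eq_mul_div, eq_div_iff (by simpa using hfac), pow_succ]
  -- The factor (-1)^n from differentiating the series is its own inverse; with the -1/3 it gives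
  -- the sign (-1)^m, m = n+1.
  linear_combination 3 * (-1) ^ n * h - 3 * (Nat.factorial n : ℂ) * harmonicPowSum (n + 1) z * hsign

/-- The series over `k ≥ 1` is indexed here by `j = k - 1 ≥ 0`. -/
theorem corollary3p12 :
    (∀ (p : ℂ) (m : ℕ), (∀ n : ℕ, p ≠ -(n : ℂ)) → 1 ≤ m →
      HasSum
        (fun j : ℕ => (genHarmonic 1 j ^ 2 - genHarmonic 2 j)
          / (((j : ℂ) + 1) * (p + ((j : ℂ) + 1)) ^ m))
        ((-1 : ℂ) ^ m / (3 * (Nat.factorial (m - 1) : ℂ)) *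
          ∑ l ∈ Finset.range m,
            (Nat.choose (m - 1) l : ℂ) * (-1 : ℂ) ^ (m - 1 - l)
              * ((Nat.factorial (m - 1 - l) : ℂ) / p ^ (m - l)) * iteratedDeriv l gFun p)) ∧
    DifferentiableOn ℂ gFun {z : ℂ | ∀ n : ℕ, z + 1 ≠ -(n : ℂ)} ∧
    (∀ (z : ℂ) (l : ℕ), (∀ n : ℕ, z + 1 ≠ -(n : ℂ)) → 1 ≤ l →
      iteratedDeriv l gFun z =
        -3 * ((Real.eulerMascheroniConstant : ℂ) ^ 2 + riemannZeta 2) * polygamma l (z + 1)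
        + 3 * (Real.eulerMascheroniConstant : ℂ) * polygamma (l + 1) (z + 1)
        - polygamma (l + 2) (z + 1)
        + 3 * ∑ j ∈ Finset.range (l + 1),
            (Nat.choose l j : ℂ) * polygamma (j + 1) (z + 1) * polygamma (l - j) (z + 1)
        - 3 * (Real.eulerMascheroniConstant : ℂ) * ∑ j ∈ Finset.range (l + 1),
            (Nat.choose l j : ℂ) * polygamma j (z + 1) * polygamma (l - j) (z + 1)
        - ∑ k ∈ Finset.range (l + 1), (Nat.choose l k : ℂ) *
            (∑ j ∈ Finset.range (k + 1),
              (Nat.choose k j : ℂ) * polygamma j (z + 1) * polygamma (k - j) (z + 1))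
            * polygamma (l - k) (z + 1)) := by
  refine ⟨fun p m hp hm => ?_, fun z hz => ?_, fun z l hz hl => iteratedDeriv_gFun hz hl⟩
  · have hmem : p ∈ complNegInt := fun n h => hp (n + 1) (by push_cast; linear_combination h)
    rw [← harmonicPowSum_eq hmem (by simpa using hp 0) hm]
    refine (summable_harmonicPowSum hm hmem).hasSum.congr_fun fun j => ?_
    rw [div_div, add_comm p, harmonicSqSub]
  · exact (analyticAt_gFun hz).differentiableAt.differentiableWithinAt
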